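/- Let $\mathbb F_q$ be a finite field; all vector spaces are finite-dimensional over $\mathbb F_q$, and $\mathcal L(E)$ is the lattice of subspaces of $E$. A $q$-matroid $M=(E,r)$ is a function $r:\mathcal L(E)\to\mathbb Z$ with $0\le r(A)\le\dim A$, $r(A)\le r(B)$ for $A\le B$, and $r(A+B)+r(A\cap B)\le r(A)+r(B)$; $A$ is independent if $r(A)=\dim A$. Two $q$-matroids are isomorphic, $M_1\cong M_2$, if some linear isomorphism of their ground spaces preserves the rank of every subspace. For $A\le B\le E$ the minor $M[A,B]$ is the $q$-matroid on $B/A$ with rank $X/A\mapsto r(X)-r(A)$ for $A\le X\le B$. The free product $M_1\square M_2$ of $M_i=(E_i,r_i)$ is the $q$-matroid on $E_1\oplus E_2$ whose independent spaces are the $I\le E_1\oplus E_2$ such that $I_1:=\pi_1(I\cap (E_1\oplus 0))$ is independent in $M_1$ and $r_1(E_1)-r_1(I_1)\ge\dim\pi_2(I)-r_2(\pi_2(I))$, and $M_1\square\cdots\square M_k:=M_1\square(M_2\square(\cdots\square M_k))$. A map $\tau:\mathcal L(E_1)\to\mathcal L(E_2)$ is a weak map from $(E_1,r_1)$ to $(E_2,r_2)$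 if $r_2(\tau(X))\le r_1(X)$ for all $X$, and $M_2\preceq M_1$ means that some lattice isomorphism $\mathcal L(E_1)\to\mathcal L(E_2)$ is a weak map from $M_1$ to $M_2$. (1) Let $M=(E,r)$ be a $q$-matroid, let $0=V_0<V_1<\dots<V_k=E$ be a chain of subspaces, and let $M_i=M[V_{i-1},V_i]$. Identify $V_1/V_0\oplus\cdots\oplus V_k/V_{k-1}$ with $E$ by means of any choice of complements of $V_{i-1}$ in $V_i$ ($1\le i\le k$), so that $M_1\square\cdots\square M_k$ becomes a $q$-matroid on $E$. Then the identity map on $E$ is a weak map from $M_1\square\cdots\square M_k$ to $M$. (2) Let $M_1,\dots,M_k$ be $q$-matroids on nonzero ground spaces, and let $\mathcal M_q(M_1,\dots,M_k)$ be the class of $q$-matroids $N$ whose ground space $E$ has a chain $0=V_0<V_1<\dots<V_k=E$ with $N[V_{i-1},V_i]\cong M_i$ for all $i$, considered up to isomorphism and ordered by $\preceq$. Then $P:=M_1\square\cdots\square M_k$ is maximal in $\mathcal M_q(M_1,\dots,M_k)$. More precisely, $P$ belongs to $\mathcal M_q(M_1,\dots,M_k)$, every $N\in\mathcal M_q(M_1,\dots,M_k)$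 satisfies $N\preceq P$, and if also $P\preceq N$, then $N\cong P$. -/

import Mathlib

open Module

/-- A `q`-matroid with ground space `E`, given by its rank function on the subspaces of `E`. -/
structure QMatroid (F : Type*) (E : Type*) [Field F] [AddCommGroup E] [Module F E] where
  /-- the rank function -/
  r : Submodule F E → ℤ
  r_nonneg : ∀ A, 0 ≤ r A
  r_le_dim : ∀ A, r A ≤ finrank F A
  r_mono : ∀ A B, A ≤ B → r A ≤ r B
  r_submod : ∀ A B, r (A ⊔ B) + r (A ⊓ B) ≤ r A + r B

namespace QMatroid

section Basic

variable {F E E₁ E₂ : Type*} [Field F]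
  [AddCommGroup E] [Module F E]
  [AddCommGroup E₁] [Module F E₁] [AddCommGroup E₂] [Module F E₂]

/-- `A` is independent if `r A = dim A`. -/
def Indep (M : QMatroid F E) (A : Submodule F E) : Prop := M.r A = finrank F A

/-- The rank-lack function `λ(A) = r(E) - r(A)`. -/
def rankLack (M : QMatroid F E) (A : Submodule F E) : ℤ := M.r ⊤ - M.r A

/-- The nullity function `ν(A) = dim A - r(A)`. -/
noncomputable def nullity (M : QMatroid F E) (A : Submodule F E) : ℤ := finrank F A - M.r A

/-- Two `q`-matroids are isomorphic if a linear isomorphism of the ground spaces preserves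
the rank functions. -/
def Isomorphic (M₁ : QMatroid F E₁) (M₂ : QMatroid F E₂) : Prop :=
  ∃ τ : E₁ ≃ₗ[F] E₂, ∀ X : Submodule F E₁,
    M₂.r (X.map (τ : E₁ →ₗ[F] E₂)) = M₁.r X

/-- A function between subspace lattices is a weak map if it does not increase the rank. -/
def IsWeakMap (M₁ : QMatroid F E₁) (M₂ : QMatroid F E₂)
    (τ : Submodule F E₁ → Submodule F E₂) : Prop :=
  ∀ X, M₂.r (τ X) ≤ M₁.r X

/-- The weak order `M₂ ⪯ M₁`: there is a weak map from `M₁` to `M₂` that is an isomorphism of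
subspace lattices. -/
def WeakLE (M₂ : QMatroid F E₂) (M₁ : QMatroid F E₁) : Prop :=
  ∃ τ : Submodule F E₁ ≃o Submodule F E₂, IsWeakMap M₁ M₂ τ

/-- Transport of a `q`-matroid along a linear isomorphism of ground spaces. -/
def transport (M : QMatroid F E₁) (e : E₁ ≃ₗ[F] E₂) : QMatroid F E₂ where
  r X := M.r (X.comap (e : E₁ →ₗ[F] E₂))
  r_nonneg X := M.r_nonneg _
  r_le_dim X := by
    refine (M.r_le_dim _).trans (le_of_eq ?_)
    congr 1
    have h := LinearEquiv.finrank_map_eq e (X.comap (e : E₁ →ₗ[F] E₂))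
    rw [← h, Submodule.map_comap_eq_of_surjective e.surjective]
  r_mono A B h := M.r_mono _ _ (Submodule.comap_mono h)
  r_submod A B := by
    have h := M.r_submod (A.comap (e : E₁ →ₗ[F] E₂)) (B.comap (e : E₁ →ₗ[F] E₂))
    have h2 : (A ⊔ B).comap (e : E₁ →ₗ[F] E₂)
        = A.comap (e : E₁ →ₗ[F] E₂) ⊔ B.comap (e : E₁ →ₗ[F] E₂) := by
      simp only [Submodule.comap_equiv_eq_map_symm, Submodule.map_sup]
    rw [h2, Submodule.comap_inf]
    exact h

/-- The `q`-matroid all of whose subspaces have rank `0`. On the zero space it is the only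
`q`-matroid. -/
def rankZero (F E : Type*) [Field F] [AddCommGroup E] [Module F E] : QMatroid F E where
  r _ := 0
  r_nonneg _ := le_rfl
  r_le_dim _ := by positivity
  r_mono _ _ _ := le_rfl
  r_submod _ _ := by simp

theorem nullity_nonneg (M : QMatroid F E) (A : Submodule F E) : 0 ≤ M.nullity A := by
  have := M.r_le_dim A
  unfold nullity
  omega

end Basic

section FiniteDim

set_option linter.unusedSectionVars false

variable {F E E₁ E₂ : Type*} [Field F]
  [AddCommGroup E] [Module F E] [FiniteDimensional F E]
  [AddCommGroup E₁] [Module F E₁] [FiniteDimensional F E₁]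
  [AddCommGroup E₂] [Module F E₂] [FiniteDimensional F E₂]

/-- A rank increment is bounded by the dimension increment. -/
theorem r_sub_le (M : QMatroid F E) (A B : Submodule F E) :
    M.r (A ⊔ B) + finrank F (A ⊓ B : Submodule F E) ≤ M.r A + finrank F B := by
  obtain ⟨C, hC⟩ := Submodule.exists_isCompl ((A ⊓ B).submoduleOf B)
  set D : Submodule F E := C.map B.subtype with hD
  have hDB : D ≤ B := Submodule.map_subtype_le B C
  have hmap : ((A ⊓ B).submoduleOf B).map B.subtype = A ⊓ B := by
    rw [Submodule.submoduleOf, Submodule.map_comap_subtype]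
    simp
  have hsup : (A ⊓ B) ⊔ D = B := by
    rw [← hmap, hD, ← Submodule.map_sup, hC.sup_eq_top, Submodule.map_subtype_top]
  have hdim : finrank F D + finrank F (A ⊓ B : Submodule F E) = finrank F B := by
    have h1 := Submodule.finrank_add_eq_of_isCompl hC
    have h2 : finrank F D = finrank F C :=
      (Submodule.equivMapOfInjective B.subtype B.injective_subtype C).finrank_eq.symm
    have h3 : finrank F (A ⊓ B : Submodule F E) = finrank F ((A ⊓ B).submoduleOf B) := by
      conv_lhs => rw [← hmap]
      exact (Submodule.equivMapOfInjective B.subtype B.injective_subtype _).finrank_eq.symm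
    omega
  have hAD : A ⊔ B = A ⊔ D := by
    rw [← hsup, ← sup_assoc, sup_eq_left.mpr (inf_le_left : A ⊓ B ≤ A)]
  have h1 := M.r_submod A D
  have h2 := M.r_nonneg (A ⊓ D)
  have h3 := M.r_le_dim D
  rw [hAD]
  omega

theorem nullity_mono (M : QMatroid F E) {A B : Submodule F E} (h : A ≤ B) :
    M.nullity A ≤ M.nullity B := by
  have := M.r_sub_le A B
  rw [sup_eq_right.mpr h, inf_eq_left.mpr h] at this
  unfold nullity
  omega

theorem Indep.mono {M : QMatroid F E} {A B : Submodule F E} (hB : M.Indep B) (h : A ≤ B) :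
    M.Indep A := by
  have h1 := M.nullity_mono h
  have h2 := M.nullity_nonneg A
  unfold nullity at h1 h2
  unfold Indep at *
  omega

/-- Every subspace contains an independent subspace of the same rank. -/
theorem exists_indep_le (M : QMatroid F E) (X : Submodule F E) :
    ∃ I ≤ X, M.Indep I ∧ M.r I = M.r X := by
  have hbot : M.Indep (⊥ : Submodule F E) := by
    have h1 := M.r_nonneg ⊥
    have h2 := M.r_le_dim ⊥
    unfold Indep
    simp at *
    omega
  obtain ⟨I, ⟨hIX, hI⟩, hmax⟩ := WellFounded.has_min
    (wellFounded_gt : WellFounded ((· > ·) : Submodule F E → Submodule F E → Prop))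
    {I : Submodule F E | I ≤ X ∧ M.Indep I} ⟨⊥, bot_le, hbot⟩
  obtain ⟨J, ⟨hJX, hIJ, hJ⟩, hJmax⟩ := WellFounded.has_min
    (wellFounded_gt : WellFounded ((· > ·) : Submodule F E → Submodule F E → Prop))
    {J : Submodule F E | J ≤ X ∧ I ≤ J ∧ M.r J = M.r I} ⟨I, hIX, le_rfl, rfl⟩
  refine ⟨I, hIX, hI, ?_⟩
  suffices J = X by rw [← this, hJ]
  refine le_antisymm hJX fun x hx => ?_
  by_contra hxJ
  set L : Submodule F E := Submodule.span F {x} with hL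
  have hLX : L ≤ X := by rwa [hL, Submodule.span_singleton_le_iff_mem]
  have hxI : x ∉ I := fun h => hxJ (hIJ h)
  have hlt : I < I ⊔ L := by
    refine lt_of_le_of_ne le_sup_left fun h => hxI ?_
    rw [h]
    exact Submodule.mem_sup_right (Submodule.mem_span_singleton_self x)
  have hltJ : J < J ⊔ L := by
    refine lt_of_le_of_ne le_sup_left fun h => hxJ ?_
    rw [h]
    exact Submodule.mem_sup_right (Submodule.mem_span_singleton_self x)
  have hnot : ¬ M.Indep (I ⊔ L) := fun h => hmax _ ⟨sup_le hIX hLX, h⟩ hlt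
  have hd := Submodule.finrank_add_le_finrank_add_finrank I L
  have hd1 : finrank F L ≤ 1 := by
    have := finrank_span_le_card (R := F) ({x} : Set E)
    simpa using this
  have hd2 := Submodule.finrank_lt_finrank_of_lt hlt
  have h1 := M.r_le_dim (I ⊔ L)
  have h2 := M.r_mono I (I ⊔ L) le_sup_left
  have hrI : M.r (I ⊔ L) = M.r I := by
    unfold Indep at hI hnot
    omega
  have h3 := M.r_submod J (I ⊔ L)
  have h4 := M.r_mono I (J ⊓ (I ⊔ L)) (le_inf hIJ le_sup_left)
  have h5 : J ⊔ (I ⊔ L) = J ⊔ L := by rw [← sup_assoc, sup_eq_left.mpr hIJ]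
  have h6 := M.r_mono J (J ⊔ L) le_sup_left
  rw [h5] at h3
  exact hJmax _ ⟨sup_le hJX hLX, hIJ.trans le_sup_left, by omega⟩ hltJ

theorem finrank_comap_mkQ (P : Submodule F E) (T : Submodule F (E ⧸ P)) :
    finrank F (T.comap P.mkQ) = finrank F T + finrank F P := by
  have hPT : P ≤ T.comap P.mkQ := Submodule.le_comap_mkQ P T
  have h4 := LinearMap.finrank_range_add_finrank_ker (P.mkQ.domRestrict (T.comap P.mkQ))
  have h5 : LinearMap.range (P.mkQ.domRestrict (T.comap P.mkQ)) = T := by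
    rw [LinearMap.range_domRestrict,
      Submodule.map_comap_eq_of_surjective (Submodule.mkQ_surjective P)]
  have h6 : (LinearMap.ker (P.mkQ.domRestrict (T.comap P.mkQ))).map
      (T.comap P.mkQ).subtype = P := by
    rw [LinearMap.ker_domRestrict, Submodule.map_comap_subtype,
      Submodule.ker_mkQ, inf_eq_right.mpr hPT]
  have h7 := (Submodule.equivMapOfInjective (T.comap P.mkQ).subtype
    (T.comap P.mkQ).injective_subtype
    (LinearMap.ker (P.mkQ.domRestrict (T.comap P.mkQ)))).finrank_eq
  rw [h6] at h7
  rw [h5] at h4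
  omega

theorem comap_mkQ_sup (P : Submodule F E) (S T : Submodule F (E ⧸ P)) :
    (S ⊔ T).comap P.mkQ = S.comap P.mkQ ⊔ T.comap P.mkQ := by
  have h : (S.comap P.mkQ ⊔ T.comap P.mkQ).map P.mkQ = S ⊔ T := by
    rw [Submodule.map_sup, Submodule.map_comap_eq_of_surjective (Submodule.mkQ_surjective P),
      Submodule.map_comap_eq_of_surjective (Submodule.mkQ_surjective P)]
  rw [← h, Submodule.comap_map_eq, Submodule.ker_mkQ, sup_eq_left]
  exact (Submodule.le_comap_mkQ P S).trans le_sup_left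

/-- The minor `M[A, B]`, with ground space `B / A` and rank function
`r(X) - r(A)` for `A ≤ X ≤ B`. -/
def minor (M : QMatroid F E) (A B : Submodule F E) (h : A ≤ B) :
    QMatroid F (B ⧸ A.submoduleOf B) where
  r T := M.r ((T.comap (A.submoduleOf B).mkQ).map B.subtype) - M.r A
  r_nonneg T := by
    have : A ≤ (T.comap (A.submoduleOf B).mkQ).map B.subtype := by
      intro a ha
      refine ⟨⟨a, h ha⟩, ?_, rfl⟩
      have : (A.submoduleOf B).mkQ ⟨a, h ha⟩ = 0 := by
        rw [Submodule.mkQ_apply, Submodule.Quotient.mk_eq_zero]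
        exact ha
      simp only [Submodule.comap_coe, Set.mem_preimage, SetLike.mem_coe]
      rw [this]
      exact T.zero_mem
    have := M.r_mono _ _ this
    omega
  r_le_dim T := by
    have hA : (A.submoduleOf B).map B.subtype = A := by
      rw [Submodule.submoduleOf, Submodule.map_comap_subtype, inf_eq_right.mpr h]
    have hAY : A ≤ (T.comap (A.submoduleOf B).mkQ).map B.subtype := by
      conv_lhs => rw [← hA]
      exact Submodule.map_mono (Submodule.le_comap_mkQ _ T)
    have h1 := M.r_sub_le A ((T.comap (A.submoduleOf B).mkQ).map B.subtype)
    rw [sup_eq_right.mpr hAY, inf_eq_left.mpr hAY] at h1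
    have hd1 : finrank F ((T.comap (A.submoduleOf B).mkQ).map B.subtype) =
        finrank F (T.comap (A.submoduleOf B).mkQ) :=
      (Submodule.equivMapOfInjective B.subtype B.injective_subtype _).finrank_eq.symm
    have hd2 : finrank F A = finrank F (A.submoduleOf B) := by
      conv_lhs => rw [← hA]
      exact (Submodule.equivMapOfInjective B.subtype B.injective_subtype _).finrank_eq.symm
    have hd3 := finrank_comap_mkQ (A.submoduleOf B) T
    omega
  r_mono S T hST := by
    have := M.r_mono _ _ (Submodule.map_mono (f := B.subtype)
      (Submodule.comap_mono (f := (A.submoduleOf B).mkQ) hST))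
    omega
  r_submod S T := by
    have h1 := M.r_submod ((S.comap (A.submoduleOf B).mkQ).map B.subtype)
      ((T.comap (A.submoduleOf B).mkQ).map B.subtype)
    rw [← Submodule.map_sup, ← Submodule.map_inf _ B.injective_subtype,
      ← Submodule.comap_inf] at h1
    rw [comap_mkQ_sup]
    omega

/-! ### The free product of two `q`-matroids -/

/-- `π₁(X ∩ ι₁(E₁))` for `X ≤ E₁ ⊕ E₂`. -/
def fstPart (X : Submodule F (E₁ × E₂)) : Submodule F E₁ :=
  (X ⊓ (⊤ : Submodule F E₁).map (LinearMap.inl F E₁ E₂)).map (LinearMap.fst F E₁ E₂)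

/-- `π₂(X)` for `X ≤ E₁ ⊕ E₂`. -/
def sndPart (X : Submodule F (E₁ × E₂)) : Submodule F E₂ :=
  X.map (LinearMap.snd F E₁ E₂)

/-- The independent spaces of the free product: the `I ≤ E₁ ⊕ E₂` such that
`π₁(I ∩ ι₁(E₁))` is independent in `M₁` and `λ₁(π₁(I ∩ ι₁(E₁))) ≥ ν₂(π₂(I))`. -/
def freeIndep (M₁ : QMatroid F E₁) (M₂ : QMatroid F E₂) (I : Submodule F (E₁ × E₂)) : Prop :=
  M₁.Indep (fstPart I) ∧ M₂.nullity (sndPart I) ≤ M₁.rankLack (fstPart I)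

/-- The rank of `X` in the free product: the largest `dim (X ∩ I)` for `I` independent. -/
noncomputable def freeRank (M₁ : QMatroid F E₁) (M₂ : QMatroid F E₂)
    (X : Submodule F (E₁ × E₂)) : ℕ :=
  sSup {d : ℕ | ∃ I, freeIndep M₁ M₂ I ∧ d = finrank F (X ⊓ I : Submodule F (E₁ × E₂))}

theorem fstPart_eq (X : Submodule F (E₁ × E₂)) :
    fstPart X = X.comap (LinearMap.inl F E₁ E₂) := by
  ext a
  simp only [fstPart, Submodule.mem_map, Submodule.mem_inf, Submodule.mem_comap]
  constructor
  · rintro ⟨_, ⟨hx, b, -, rfl⟩, rfl⟩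
    exact hx
  · intro h
    exact ⟨_, ⟨h, a, trivial, rfl⟩, rfl⟩

theorem fstPart_mono {X Y : Submodule F (E₁ × E₂)} (h : X ≤ Y) : fstPart X ≤ fstPart Y := by
  rw [fstPart_eq, fstPart_eq]
  exact Submodule.comap_mono h

theorem sndPart_mono {X Y : Submodule F (E₁ × E₂)} (h : X ≤ Y) : sndPart X ≤ sndPart Y :=
  Submodule.map_mono h

theorem finrank_fst_add_snd (X : Submodule F (E₁ × E₂)) :
    finrank F (fstPart X) + finrank F (sndPart X) = finrank F X := by
  have h1 := LinearMap.finrank_range_add_finrank_ker ((LinearMap.snd F E₁ E₂).domRestrict X)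
  rw [LinearMap.range_domRestrict] at h1
  have h2 : (LinearMap.ker ((LinearMap.snd F E₁ E₂).domRestrict X)).map X.subtype =
      (fstPart X).map (LinearMap.inl F E₁ E₂) := by
    rw [LinearMap.ker_domRestrict, Submodule.map_comap_subtype, fstPart_eq,
      Submodule.map_comap_eq, LinearMap.range_inl, inf_comm]
  have h3 := (Submodule.equivMapOfInjective X.subtype X.injective_subtype
    (LinearMap.ker ((LinearMap.snd F E₁ E₂).domRestrict X))).finrank_eq
  have h4 := (Submodule.equivMapOfInjective (LinearMap.inl F E₁ E₂)
    LinearMap.inl_injective (fstPart X)).finrank_eq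
  rw [h2] at h3
  unfold sndPart
  omega

/-- An auxiliary `q`-matroid, given by a closed formula for the rank; it is used to show that
`freeRank` is a rank function. -/
noncomputable def freeAux (M₁ : QMatroid F E₁) (M₂ : QMatroid F E₂) : QMatroid F (E₁ × E₂) where
  r X := M₁.r (fstPart X) + M₂.r (sndPart X)
    + min (M₁.rankLack (fstPart X)) (M₂.nullity (sndPart X))
  r_nonneg X := by
    have h1 := M₁.r_nonneg (fstPart X)
    have h2 := M₂.r_nonneg (sndPart X)
    have h3 := M₁.r_mono (fstPart X) ⊤ le_top
    have h4 := M₂.nullity_nonneg (sndPart X)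
    unfold rankLack
    omega
  r_le_dim X := by
    have h1 := M₁.r_le_dim (fstPart X)
    have h2 := finrank_fst_add_snd X
    unfold rankLack nullity
    omega
  r_mono X Y h := by
    have h1 := M₁.r_mono _ _ (fstPart_mono h)
    have h2 := M₂.r_mono _ _ (sndPart_mono h)
    have h3 := Submodule.finrank_mono (sndPart_mono h)
    unfold rankLack nullity
    omega
  r_submod X Y := by
    have hA : fstPart (X ⊓ Y) = fstPart X ⊓ fstPart Y := by
      simp only [fstPart_eq, Submodule.comap_inf]
    have hB : sndPart (X ⊔ Y) = sndPart X ⊔ sndPart Y := Submodule.map_sup _ _ _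
    have hA' : fstPart X ⊔ fstPart Y ≤ fstPart (X ⊔ Y) :=
      sup_le (fstPart_mono le_sup_left) (fstPart_mono le_sup_right)
    have hB' : sndPart (X ⊓ Y) ≤ sndPart X ⊓ sndPart Y :=
      le_inf (sndPart_mono inf_le_left) (sndPart_mono inf_le_right)
    have a1 := M₁.nullity_mono hA'
    have a2 := M₁.r_submod (fstPart X) (fstPart Y)
    have a3 := Submodule.finrank_sup_add_finrank_inf_eq (fstPart X) (fstPart Y)
    have a4 := M₁.r_mono (fstPart X ⊓ fstPart Y) _ inf_le_left
    have a5 := M₁.r_mono (fstPart X ⊓ fstPart Y) _ inf_le_right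
    have b1 := M₂.r_mono _ _ hB'
    have b2 := M₂.r_submod (sndPart X) (sndPart Y)
    have b3 := Submodule.finrank_mono hB'
    have b4 := M₂.r_sub_le (sndPart X) (sndPart Y)
    have b5 := M₂.r_sub_le (sndPart Y) (sndPart X)
    rw [sup_comm, inf_comm] at b5
    have d1 := finrank_fst_add_snd X
    have d2 := finrank_fst_add_snd Y
    have d3 := finrank_fst_add_snd (X ⊔ Y)
    have d4 := finrank_fst_add_snd (X ⊓ Y)
    have d5 := Submodule.finrank_sup_add_finrank_inf_eq X Y
    rw [hB] at d3 ⊢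
    rw [hA] at d4 ⊢
    unfold nullity at a1
    unfold rankLack nullity
    rcases min_cases (M₁.r ⊤ - M₁.r (fstPart X))
      ((finrank F (sndPart X) : ℤ) - M₂.r (sndPart X)) with ⟨h1, _⟩ | ⟨h1, _⟩ <;>
    rcases min_cases (M₁.r ⊤ - M₁.r (fstPart Y))
      ((finrank F (sndPart Y) : ℤ) - M₂.r (sndPart Y)) with ⟨h2, _⟩ | ⟨h2, _⟩ <;>
    rw [h1, h2] <;> omega

theorem freeAux_indep_iff (M₁ : QMatroid F E₁) (M₂ : QMatroid F E₂)
    (I : Submodule F (E₁ × E₂)) : (freeAux M₁ M₂).Indep I ↔ freeIndep M₁ M₂ I := by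
  have h1 := M₁.r_le_dim (fstPart I)
  have h2 := finrank_fst_add_snd I
  unfold freeIndep Indep freeAux
  simp only
  unfold rankLack nullity
  constructor
  · intro h
    constructor <;> omega
  · rintro ⟨h3, h4⟩
    omega

theorem freeRank_eq_aux (M₁ : QMatroid F E₁) (M₂ : QMatroid F E₂)
    (X : Submodule F (E₁ × E₂)) : (freeRank M₁ M₂ X : ℤ) = (freeAux M₁ M₂).r X := by
  obtain ⟨J, hJX, hJ, hJr⟩ := (freeAux M₁ M₂).exists_indep_le X
  have hg : IsGreatest
      {d : ℕ | ∃ I, freeIndep M₁ M₂ I ∧ d = finrank F (X ⊓ I : Submodule F (E₁ × E₂))}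
      (finrank F J) := by
    constructor
    · exact ⟨J, (freeAux_indep_iff M₁ M₂ J).1 hJ, by rw [inf_eq_right.mpr hJX]⟩
    · rintro d ⟨I, hI, rfl⟩
      have h1 := ((freeAux_indep_iff M₁ M₂ I).2 hI).mono (inf_le_right : X ⊓ I ≤ I)
      have h2 := (freeAux M₁ M₂).r_mono (X ⊓ I) X inf_le_left
      unfold Indep at h1 hJ
      omega
  unfold freeRank
  rw [hg.csSup_eq, ← hJr]
  exact hJ.symm

/-- The free product `M₁ □ M₂`, with ground space `E₁ ⊕ E₂`. -/
noncomputable def freeProduct (M₁ : QMatroid F E₁) (M₂ : QMatroid F E₂) :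
    QMatroid F (E₁ × E₂) where
  r X := freeRank M₁ M₂ X
  r_nonneg X := by positivity
  r_le_dim X := by
    rw [freeRank_eq_aux]
    exact (freeAux M₁ M₂).r_le_dim X
  r_mono X Y h := by
    rw [freeRank_eq_aux, freeRank_eq_aux]
    exact (freeAux M₁ M₂).r_mono X Y h
  r_submod X Y := by
    simp only [freeRank_eq_aux]
    exact (freeAux M₁ M₂).r_submod X Y

/-- The independent spaces of `M₁ □ M₂` are the prescribed ones. -/
theorem freeProduct_indep_iff (M₁ : QMatroid F E₁) (M₂ : QMatroid F E₂)
    (I : Submodule F (E₁ × E₂)) : (freeProduct M₁ M₂).Indep I ↔ freeIndep M₁ M₂ I := by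
  rw [← freeAux_indep_iff]
  unfold Indep freeProduct
  simp only [freeRank_eq_aux]

end FiniteDim

/-- The free product `M₁ □ ⋯ □ M_k = M₁ □ (M₂ □ (⋯ □ M_k))` of a finite family, with ground space
`E₁ ⊕ ⋯ ⊕ E_k`. The recursion starts from the `q`-matroid on the zero space, which is neutral
for the free product. -/
noncomputable def freeProductFamily {F : Type*} [Field F] :
    (k : ℕ) → (E : Fin k → Type*) → [∀ i, AddCommGroup (E i)] → [∀ i, Module F (E i)] →
    [∀ i, FiniteDimensional F (E i)] → (∀ i, QMatroid F (E i)) → QMatroid F (∀ i, E i)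
  | 0, E, _, _, _, _ => rankZero F (∀ i, E i)
  | k + 1, E, _, _, _, M =>
      (freeProduct (M 0) (freeProductFamily k (fun i => E i.succ) (fun i => M i.succ))).transport
        (Fin.consLinearEquiv F E)

end QMatroid

/-- A chain `0 = V₀ < V₁ < ⋯ < V_k = E` of subspaces of `E`. -/
structure SubspaceChain (F E : Type*) [Field F] [AddCommGroup E] [Module F E] (k : ℕ) where
  /-- the members of the chain -/
  V : Fin (k + 1) → Submodule F E
  strictMono : StrictMono V
  V_zero : V 0 = ⊥
  V_last : V (Fin.last k) = ⊤

namespace SubspaceChain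

variable {F E : Type*} [Field F] [AddCommGroup E] [Module F E] {k : ℕ}

theorem le_succ (C : SubspaceChain F E k) (i : Fin k) : C.V i.castSucc ≤ C.V i.succ :=
  C.strictMono.monotone (Fin.castSucc_le_succ i)

/-- The quotient `V_i / V_{i-1}` of consecutive members of the chain. -/
abbrev Gr (C : SubspaceChain F E k) (i : Fin k) : Type _ :=
  C.V i.succ ⧸ (C.V i.castSucc).submoduleOf (C.V i.succ)

/-- A splitting of the chain: for every `i` a linear section of `V_i → V_i / V_{i-1}`, that is,
an identification of `V_i / V_{i-1}` with a complement of `V_{i-1}` in `V_i`. -/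
structure Splitting (C : SubspaceChain F E k) where
  /-- the sections -/
  s : ∀ i, C.Gr i →ₗ[F] C.V i.succ
  mkQ_s : ∀ i x, ((C.V i.castSucc).submoduleOf (C.V i.succ)).mkQ (s i x) = x

/-- Every chain has a splitting. -/
theorem nonempty_splitting (C : SubspaceChain F E k) : Nonempty C.Splitting := by
  have h : ∀ i, ∃ g : C.Gr i →ₗ[F] C.V i.succ,
      ((C.V i.castSucc).submoduleOf (C.V i.succ)).mkQ ∘ₗ g = LinearMap.id := fun i =>
    LinearMap.exists_rightInverse_of_surjective _ (Submodule.range_mkQ _)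
  choose g hg using h
  exact ⟨⟨g, fun i x => LinearMap.congr_fun (hg i) x⟩⟩

/-- The linear map `V₁/V₀ ⊕ ⋯ ⊕ V_k/V_{k-1} → E` given by a splitting. -/
def Splitting.toMap {C : SubspaceChain F E k} (σ : C.Splitting) : (∀ i, C.Gr i) →ₗ[F] E :=
  ∑ i, (C.V i.succ).subtype ∘ₗ σ.s i ∘ₗ LinearMap.proj i

theorem Splitting.toMap_single {C : SubspaceChain F E k} (σ : C.Splitting) (i : Fin k)
    (x : C.Gr i) : σ.toMap (Pi.single i x) = (σ.s i x : E) := by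
  unfold Splitting.toMap
  rw [LinearMap.sum_apply, Finset.sum_eq_single i]
  · simp
  · intro j _ hj
    simp [Pi.single_eq_of_ne hj]
  · simp

theorem Splitting.range_toMap {C : SubspaceChain F E k} (σ : C.Splitting) :
    LinearMap.range σ.toMap = ⊤ := by
  have h : ∀ i, C.V i ≤ LinearMap.range σ.toMap := by
    intro i
    induction i using Fin.induction with
    | zero => rw [C.V_zero]; exact bot_le
    | succ i ih =>
      intro v hv
      set P := (C.V i.castSucc).submoduleOf (C.V i.succ) with hP
      have h1 : (⟨v, hv⟩ : C.V i.succ) - σ.s i (P.mkQ ⟨v, hv⟩) ∈ P := by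
        rw [← Submodule.Quotient.mk_eq_zero, ← Submodule.mkQ_apply, map_sub, σ.mkQ_s, sub_self]
      have h2 : v - (σ.s i (P.mkQ ⟨v, hv⟩) : E) ∈ C.V i.castSucc := h1
      have h3 : (σ.s i (P.mkQ ⟨v, hv⟩) : E) ∈ LinearMap.range σ.toMap :=
        ⟨_, σ.toMap_single i _⟩
      have h4 := add_mem (ih h2) h3
      rwa [sub_add_cancel] at h4
  rw [eq_top_iff, ← C.V_last]
  exact h _

variable [FiniteDimensional F E]

theorem finrank_pi_quot (C : SubspaceChain F E k) :
    finrank F (∀ i, C.Gr i) = finrank F E := by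
  rw [Module.finrank_pi_fintype]
  have h1 : ∀ i : Fin k, (finrank F (C.Gr i) : ℤ) =
      finrank F (C.V i.succ) - finrank F (C.V i.castSucc) := by
    intro i
    have h2 : finrank F (C.Gr i) + finrank F ((C.V i.castSucc).submoduleOf (C.V i.succ)) =
        finrank F (C.V i.succ) := Submodule.finrank_quotient_add_finrank _
    have h3 := (Submodule.submoduleOfEquivOfLe (C.le_succ i)).finrank_eq
    omega
  have h4 : (∑ i : Fin k, (finrank F (C.Gr i) : ℤ)) =
      finrank F (C.V (Fin.last k)) - finrank F (C.V 0) := by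
    rw [Finset.sum_congr rfl fun i _ => h1 i, Finset.sum_sub_distrib]
    have h5 := Fin.sum_univ_succ fun i => (finrank F (C.V i) : ℤ)
    have h6 := Fin.sum_univ_castSucc fun i => (finrank F (C.V i) : ℤ)
    linarith
  rw [C.V_zero, C.V_last, finrank_top, finrank_bot] at h4
  have h7 : ((∑ i : Fin k, finrank F (C.Gr i) : ℕ) : ℤ) = finrank F E := by
    push_cast
    simpa using h4
  exact_mod_cast h7

/-- The identification `V₁/V₀ ⊕ ⋯ ⊕ V_k/V_{k-1} ≃ E` given by a splitting of the chain. -/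
noncomputable def Splitting.toEquiv {C : SubspaceChain F E k} (σ : C.Splitting) :
    (∀ i, C.Gr i) ≃ₗ[F] E :=
  LinearEquiv.ofBijective σ.toMap
    ⟨(LinearMap.injective_iff_surjective_of_finrank_eq_finrank C.finrank_pi_quot).2
      (LinearMap.range_eq_top.1 σ.range_toMap), LinearMap.range_eq_top.1 σ.range_toMap⟩

end SubspaceChain

namespace QMatroid

/-- The minor `M[V_{i-1}, V_i]` of `M` along a chain. -/
def chainMinor {F E : Type*} [Field F] [AddCommGroup E] [Module F E] [FiniteDimensional F E]
    {k : ℕ} (M : QMatroid F E) (C : SubspaceChain F E k) (i : Fin k) :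
    QMatroid F (C.Gr i) :=
  M.minor (C.V i.castSucc) (C.V i.succ) (C.le_succ i)

/-- Membership in the class `𝓜_q(M₁, …, M_k)`: there is a chain `0 = V₀ < ⋯ < V_k = E` such that
`N[V_{i-1}, V_i]` is isomorphic to `M_i` for all `i`. -/
def HasMinors {F E : Type*} [Field F] [AddCommGroup E] [Module F E] [FiniteDimensional F E]
    {k : ℕ} {G : Fin k → Type*} [∀ i, AddCommGroup (G i)] [∀ i, Module F (G i)]
    (N : QMatroid F E) (M : ∀ i, QMatroid F (G i)) : Prop :=
  ∃ C : SubspaceChain F E k, ∀ i, Isomorphic (N.chainMinor C i) (M i)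

end QMatroid

/-! The free product of two factors has rank `min (r₁(E₁) + r₂(π₂X)) (r₁(X ∩ E₁) + dim π₂X)`, by
`freeProduct_r`. Both terms bound the rank in any `q`-matroid whose restriction to `E₁` is `M₁` and
whose contraction by `E₁` is `M₂`: the first because `r(X) ≤ r(X + E₁)`, the second because the rank
grows by at most the dimension from `X ∩ E₁` to `X`. So the free product takes the largest rank that
these two bounds permit.

For `k` factors this is iterated in `r_comap_sub_le_freeProductFamily`. Contractions of `N` are
encoded by surjections `p` out of one fixed space, the contracted subspace being `ker p`, so no
iterated quotients occur. A splitting turns the chain into the standard flag of the direct sum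
(`Splitting.toMap_mem_lift`), whatever complements are chosen; this gives the weak maps of both
parts.

The closed formula, evaluated on the standard flag, shows that the free product has the prescribed
minors. Maximality is a counting argument: over a finite field there are finitely many subspaces, so
weak maps in both directions make the rank sums equal, and hence every inequality along the linear
weak map is an equality. -/

theorem Submodule.finrank_map_add_finrank_inf_ker {F V W : Type*} [Field F] [AddCommGroup V]
    [Module F V] [FiniteDimensional F V] [AddCommGroup W] [Module F W] (f : V →ₗ[F] W)
    (B : Submodule F V) :
    finrank F (B.map f) + finrank F (B ⊓ LinearMap.ker f : Submodule F V) = finrank F B := by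
  have h1 := LinearMap.finrank_range_add_finrank_ker (f.domRestrict B)
  rw [LinearMap.range_domRestrict] at h1
  have h2 := (Submodule.equivMapOfInjective B.subtype B.injective_subtype
    (LinearMap.ker (f.domRestrict B))).finrank_eq
  rw [LinearMap.ker_domRestrict, Submodule.map_comap_subtype] at h2
  rw [LinearMap.ker_domRestrict] at h1
  omega

/-- The vectors of `E₁ ⊕ ⋯ ⊕ E_k` whose `i`-th coordinate lies in `T` and whose later coordinates
vanish. -/
def Submodule.flagLift {F : Type*} [Field F] {k : ℕ} {E : Fin k → Type*}
    [∀ i, AddCommGroup (E i)] [∀ i, Module F (E i)] (i : Fin k) (T : Submodule F (E i)) :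
    Submodule F (∀ i, E i) where
  carrier := {x | x i ∈ T ∧ ∀ j, i < j → x j = 0}
  add_mem' := fun {x y} hx hy => ⟨T.add_mem hx.1 hy.1, fun j hj => by
    rw [Pi.add_apply, hx.2 j hj, hy.2 j hj, add_zero]⟩
  zero_mem' := ⟨T.zero_mem, fun _ _ => rfl⟩
  smul_mem' := fun c x hx => ⟨T.smul_mem c hx.1, fun j hj => by
    rw [Pi.smul_apply, hx.2 j hj, smul_zero]⟩

theorem Submodule.mem_flagLift {F : Type*} [Field F] {k : ℕ} {E : Fin k → Type*}
    [∀ i, AddCommGroup (E i)] [∀ i, Module F (E i)] {i : Fin k} {T : Submodule F (E i)}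
    {x : ∀ i, E i} : x ∈ Submodule.flagLift i T ↔ x i ∈ T ∧ ∀ j, i < j → x j = 0 := Iff.rfl

/-! ### Rank bounds for free products and the standard flag -/

namespace QMatroid

theorem r_bot {F E : Type*} [Field F] [AddCommGroup E] [Module F E] (M : QMatroid F E) :
    M.r ⊥ = 0 := by
  have h1 := M.r_nonneg ⊥
  have h2 := M.r_le_dim ⊥
  rw [finrank_bot] at h2
  exact le_antisymm (by exact_mod_cast h2) h1

/-- A closed formula for the rank function of the free product. -/
theorem freeProduct_r {F E₁ E₂ : Type*} [Field F]
    [AddCommGroup E₁] [Module F E₁] [FiniteDimensional F E₁]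
    [AddCommGroup E₂] [Module F E₂] [FiniteDimensional F E₂]
    (M₁ : QMatroid F E₁) (M₂ : QMatroid F E₂) (X : Submodule F (E₁ × E₂)) :
    (freeProduct M₁ M₂).r X =
      min (M₁.r ⊤ + M₂.r (sndPart X)) (M₁.r (fstPart X) + finrank F (sndPart X)) := by
  change (freeRank M₁ M₂ X : ℤ) = _
  rw [freeRank_eq_aux]
  change M₁.r (fstPart X) + M₂.r (sndPart X)
    + min (M₁.r ⊤ - M₁.r (fstPart X)) (finrank F (sndPart X) - M₂.r (sndPart X)) = _
  omega

/-- Submodularity bound for the rank of the preimage of a subspace of `E₁ ⊕ E₂`. -/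
theorem r_comap_prod_le {F V E₁ E₂ : Type*} [Field F]
    [AddCommGroup V] [Module F V] [FiniteDimensional F V]
    [AddCommGroup E₁] [Module F E₁] [FiniteDimensional F E₁]
    [AddCommGroup E₂] [Module F E₂] [FiniteDimensional F E₂]
    (N : QMatroid F V) (q : V →ₗ[F] E₁ × E₂) (hq : Function.Surjective q)
    (X : Submodule F (E₁ × E₂)) :
    N.r (X.comap q) ≤
      N.r (((fstPart X).map (LinearMap.inl F E₁ E₂)).comap q) + finrank F (sndPart X) := by
  -- Rank-nullity for `π₂ ∘ q` on the preimage of `X`: the dimension drop to the preimage of `X ∩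
  -- E₁` is `dim π₂(X)`.
  have h := Submodule.finrank_map_add_finrank_inf_ker (LinearMap.snd F E₁ E₂ ∘ₗ q) (X.comap q)
  have h1 : (X.comap q).map (LinearMap.snd F E₁ E₂ ∘ₗ q) = sndPart X := by
    rw [Submodule.map_comp, Submodule.map_comap_eq_of_surjective hq, sndPart]
  have h2 : X.comap q ⊓ LinearMap.ker (LinearMap.snd F E₁ E₂ ∘ₗ q) =
      ((fstPart X).map (LinearMap.inl F E₁ E₂)).comap q := by
    rw [fstPart_eq, Submodule.map_comap_eq, LinearMap.range_inl, LinearMap.ker_comp,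
      Submodule.comap_inf, inf_comm]
  rw [h1, h2] at h
  have hle : ((fstPart X).map (LinearMap.inl F E₁ E₂)).comap q ≤ X.comap q := by
    rw [← h2]; exact inf_le_left
  have h3 := N.r_sub_le _ _ |>.trans_eq' (by rw [sup_eq_right.mpr hle, inf_eq_left.mpr hle])
  omega

/-- If the minors of `N` along the flag induced by a surjection `p` onto `E₁ ⊕ ⋯ ⊕ E_k` are bounded
by `M₁, …, M_k`, then the contraction of `N` by the kernel of `p` is bounded by
`M₁ □ ⋯ □ M_k`. -/
theorem r_comap_sub_le_freeProductFamily {F V : Type*} [Field F] [AddCommGroup V] [Module F V]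
    [FiniteDimensional F V] (N : QMatroid F V) (k : ℕ) (E : Fin k → Type*)
    [∀ i, AddCommGroup (E i)] [∀ i, Module F (E i)] [∀ i, FiniteDimensional F (E i)]
    (M : ∀ i, QMatroid F (E i)) (p : V →ₗ[F] ∀ i, E i) (hp : Function.Surjective p)
    (h : ∀ i (T : Submodule F (E i)), N.r ((Submodule.flagLift i T).comap p)
      - N.r ((Submodule.flagLift i (⊥ : Submodule F (E i))).comap p) ≤ (M i).r T)
    (X : Submodule F (∀ i, E i)) :
    N.r (X.comap p) - N.r (LinearMap.ker p) ≤ (freeProductFamily k E M).r X := by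
  induction k with
  | zero =>
    have h1 : X.comap p = LinearMap.ker p := by
      rw [Subsingleton.elim X ⊥]; rfl
    rw [h1, sub_self]
    exact r_nonneg _ _
  | succ k ih =>
    set c := Fin.consLinearEquiv F E with hc
    -- The map `p` with coordinate `0` split off. Its second component is the surjection for the
    -- induction step, and the kernel of that component is the preimage of `E 0`, so passing to the
    -- tail contracts by one more member of the flag.
    set q : V →ₗ[F] E 0 × ∀ i : Fin k, E i.succ := c.symm.toLinearMap ∘ₗ p with hq
    have hqs : Function.Surjective q := c.symm.surjective.comp hp
    set Y : Submodule F (E 0 × ∀ i : Fin k, E i.succ) := X.comap c.toLinearMap with hY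
    have hq1 : ∀ v, (q v).1 = p v 0 := fun v => rfl
    have hq2 : ∀ v i, (q v).2 i = p v i.succ := fun v i => rfl
    have hXY : X.comap p = Y.comap q := by
      ext v
      simp [hY, hq]
    have hker : (Submodule.flagLift (0 : Fin (k + 1)) (⊥ : Submodule F (E 0))).comap p =
        LinearMap.ker p := by
      ext v
      simp only [Submodule.mem_comap, Submodule.mem_flagLift, Submodule.mem_bot,
        LinearMap.mem_ker]
      refine ⟨fun hv => funext fun i => ?_, fun hv => by simp [hv]⟩
      rcases Fin.eq_zero_or_eq_succ i with rfl | ⟨j, rfl⟩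
      · exact hv.1
      · exact hv.2 _ (Fin.succ_pos j)
    have hT : ∀ T : Submodule F (E 0), (Submodule.flagLift (0 : Fin (k + 1)) T).comap p =
        (T.map (LinearMap.inl F (E 0) (∀ i : Fin k, E i.succ))).comap q := by
      intro T
      ext v
      simp only [Submodule.mem_comap, Submodule.mem_flagLift, Submodule.mem_map]
      constructor
      · rintro ⟨hv, hv'⟩
        refine ⟨_, hv, Prod.ext rfl (funext fun i => ?_)⟩
        rw [hq2, hv' _ (Fin.succ_pos i)]
        rfl
      · rintro ⟨a, ha, hav⟩
        refine ⟨?_, fun j hj => ?_⟩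
        · rw [← hq1, ← hav]; exact ha
        · obtain ⟨i, rfl⟩ := Fin.exists_succ_eq.2 hj.ne'
          rw [← hq2, ← hav]; rfl
    have hU : ∀ (i : Fin k) (T : Submodule F (E i.succ)),
        (Submodule.flagLift i T).comap (LinearMap.snd F _ _ ∘ₗ q) =
          (Submodule.flagLift i.succ T).comap p := by
      intro i T
      ext v
      simp only [Submodule.mem_comap, Submodule.mem_flagLift]
      refine and_congr Iff.rfl ⟨fun hv j hj => ?_, fun hv j hj => ?_⟩
      · obtain ⟨l, rfl⟩ := Fin.exists_succ_eq.2 ((Fin.zero_le _).trans_lt hj).ne'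
        exact hv l (Fin.succ_lt_succ_iff.1 hj)
      · exact hv j.succ (Fin.succ_lt_succ_iff.2 hj)
    have ih' := ih (fun i => E i.succ) (fun i => M i.succ) (LinearMap.snd F _ _ ∘ₗ q)
      (Prod.snd_surjective.comp hqs) (fun i T => by rw [hU, hU]; exact h i.succ T)
      (sndPart Y)
    have hker' : LinearMap.ker (LinearMap.snd F (E 0) (∀ i : Fin k, E i.succ) ∘ₗ q) =
        (Submodule.flagLift (0 : Fin (k + 1)) (⊤ : Submodule F (E 0))).comap p := by
      rw [hT, Submodule.map_top, LinearMap.range_inl, LinearMap.ker_comp]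
    have h0 := h 0 ⊤
    have h1 := h 0 (fstPart Y)
    have h2 := N.r_comap_prod_le q hqs Y
    have h3 : N.r (Y.comap q) ≤ N.r ((sndPart Y).comap (LinearMap.snd F _ _ ∘ₗ q)) :=
      N.r_mono _ _ fun v hv => ⟨q v, hv, rfl⟩
    change _ ≤ (freeProduct (M 0) (freeProductFamily k _ _)).r Y
    rw [freeProduct_r, hXY]
    rw [hker, ← hker'] at h0
    rw [hker, hT] at h1
    -- The first bound enlarges the preimage of `Y` by that of `E 0` and adds `ih'` to `h0`; the
    -- second adds `h2` to `h1`.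
    refine le_min ?_ ?_ <;> linarith

/-- The minors of `M₁ □ ⋯ □ M_k` along the flag of its ground space are `M₁, …, M_k`. -/
theorem freeProductFamily_r_flagLift {F : Type*} [Field F] (k : ℕ) (E : Fin k → Type*)
    [∀ i, AddCommGroup (E i)] [∀ i, Module F (E i)] [∀ i, FiniteDimensional F (E i)]
    (M : ∀ i, QMatroid F (E i)) (i : Fin k) (T : Submodule F (E i)) :
    (freeProductFamily k E M).r (Submodule.flagLift i T)
      - (freeProductFamily k E M).r (Submodule.flagLift i (⊥ : Submodule F (E i)))
      = (M i).r T := by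
  induction k with
  | zero => exact i.elim0
  | succ k ih =>
    have hr : ∀ X, (freeProductFamily (k + 1) E M).r X =
        (freeProduct (M 0) (freeProductFamily k (fun i => E i.succ) (fun i => M i.succ))).r
          (X.comap (Fin.consLinearEquiv F E).toLinearMap) := fun X => rfl
    rcases Fin.eq_zero_or_eq_succ i with rfl | ⟨j, rfl⟩
    -- Inside the first factor `π₂` vanishes, so the minimum is `min (r ⊤) (r T) = r T`.
    · have key : ∀ T : Submodule F (E 0),
          (freeProductFamily (k + 1) E M).r (Submodule.flagLift 0 T) = (M 0).r T := by
        intro T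
        have h1 : fstPart ((Submodule.flagLift (0 : Fin (k + 1)) T).comap
            (Fin.consLinearEquiv F E).toLinearMap) = T := by
          rw [fstPart_eq]
          ext a
          simp only [Submodule.mem_comap, Submodule.mem_flagLift]
          refine ⟨fun h => h.1, fun h => ⟨h, fun j hj => ?_⟩⟩
          obtain ⟨l, rfl⟩ := Fin.exists_succ_eq.2 hj.ne'
          rfl
        have h2 : sndPart ((Submodule.flagLift (0 : Fin (k + 1)) T).comap
            (Fin.consLinearEquiv F E).toLinearMap) = ⊥ := by
          rw [eq_bot_iff]
          rintro _ ⟨x, hx, rfl⟩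
          exact funext fun l => hx.2 l.succ (Fin.succ_pos l)
        rw [hr, freeProduct_r, h1, h2, r_bot, finrank_bot]
        have := (M 0).r_mono T ⊤ le_top
        omega
      rw [key, key, r_bot, sub_zero]
    -- These subspaces contain the whole first factor, so both terms of the minimum start with `(M
    -- 0).r ⊤`, and rank is at most dimension in the tail. The constant cancels in the difference.
    · have key : ∀ T : Submodule F (E j.succ),
          (freeProductFamily (k + 1) E M).r (Submodule.flagLift j.succ T) =
            (M 0).r ⊤ + (freeProductFamily k (fun i => E i.succ) (fun i => M i.succ)).r
              (Submodule.flagLift j T) := by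
        intro T
        have h1 : fstPart ((Submodule.flagLift j.succ T).comap
            (Fin.consLinearEquiv F E).toLinearMap) = ⊤ := by
          rw [fstPart_eq, eq_top_iff]
          intro a _
          refine ⟨T.zero_mem, fun l hl => ?_⟩
          obtain ⟨l, rfl⟩ := Fin.exists_succ_eq.2 ((Fin.zero_le _).trans_lt hl).ne'
          rfl
        have h2 : sndPart ((Submodule.flagLift j.succ T).comap
            (Fin.consLinearEquiv F E).toLinearMap) = Submodule.flagLift j T := by
          ext y
          constructor
          · rintro ⟨x, hx, rfl⟩
            exact ⟨hx.1, fun l hl => hx.2 l.succ (Fin.succ_lt_succ_iff.2 hl)⟩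
          · intro hy
            refine ⟨(0, y), ⟨hy.1, fun l hl => ?_⟩, rfl⟩
            obtain ⟨l, rfl⟩ := Fin.exists_succ_eq.2 ((Fin.zero_le _).trans_lt hl).ne'
            exact hy.2 l (Fin.succ_lt_succ_iff.1 hl)
        rw [hr, freeProduct_r, h1, h2]
        have := (freeProductFamily k (fun i => E i.succ) (fun i => M i.succ)).r_le_dim
          (Submodule.flagLift j T)
        omega
      rw [key, key, ← ih (fun i => E i.succ) (fun i => M i.succ) j T]
      ring

end QMatroid

/-! ### Splittings carry the standard flag to the chain -/

namespace SubspaceChain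

variable {F E : Type*} [Field F] [AddCommGroup E] [Module F E] {k : ℕ}

/-- The preimage in `E` of a subspace of `V_i / V_{i-1}`. -/
def lift (C : SubspaceChain F E k) (i : Fin k) (T : Submodule F (C.Gr i)) : Submodule F E :=
  (T.comap ((C.V i.castSucc).submoduleOf (C.V i.succ)).mkQ).map (C.V i.succ).subtype

theorem lift_bot (C : SubspaceChain F E k) (i : Fin k) : C.lift i ⊥ = C.V i.castSucc := by
  rw [lift, Submodule.comap_bot, Submodule.ker_mkQ, Submodule.submoduleOf,
    Submodule.map_comap_subtype, inf_eq_right.mpr (C.le_succ i)]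

theorem Splitting.toMap_apply {C : SubspaceChain F E k} (σ : C.Splitting) (x : ∀ i, C.Gr i) :
    σ.toMap x = ∑ i, (σ.s i (x i) : E) := by
  simp [Splitting.toMap]

/-- In the sum defining `toMap`, the terms after `i` vanish and each term `j < i` lies in `C.V
j.succ`, which is contained in `C.V i.castSucc`. -/
theorem Splitting.toMap_sub_mem {C : SubspaceChain F E k} (σ : C.Splitting) (x : ∀ i, C.Gr i)
    (i : Fin k) (hx : ∀ j, i < j → x j = 0) :
    σ.toMap x - (σ.s i (x i) : E) ∈ C.V i.castSucc := by
  rw [σ.toMap_apply, ← Finset.add_sum_erase _ _ (Finset.mem_univ i), add_sub_cancel_left]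
  refine Submodule.sum_mem _ fun j hj => ?_
  rcases lt_or_gt_of_ne (Finset.ne_of_mem_erase hj) with h | h
  · exact C.strictMono.monotone (Fin.succ_le_castSucc_iff.2 h) (σ.s j (x j)).2
  · rw [hx j h, map_zero]
    exact Submodule.zero_mem _

/-- Downward induction on `j`: once the later coordinates vanish, `σ.toMap x` agrees with `σ.s j (x
j)` modulo `C.V j.castSucc`, which also contains `σ.toMap x`; hence the class `x j` is zero. -/
theorem Splitting.apply_eq_zero {C : SubspaceChain F E k} (σ : C.Splitting) (x : ∀ i, C.Gr i)
    (i : Fin (k + 1)) (hx : σ.toMap x ∈ C.V i) (j : Fin k) (hj : i ≤ j.castSucc) : x j = 0 := by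
  induction j using WellFoundedGT.induction with
  | ind j ih =>
    have h1 := σ.toMap_sub_mem x j fun l hl =>
      ih l hl (hj.trans (Fin.castSucc_le_castSucc_iff.2 hl.le))
    have h2 := Submodule.sub_mem _ (C.strictMono.monotone hj hx) h1
    rw [sub_sub_cancel] at h2
    rw [← σ.mkQ_s j (x j), Submodule.mkQ_apply, Submodule.Quotient.mk_eq_zero]
    exact h2

/-- The right-hand side does not mention `σ`: changing a complement only alters vectors modulo
earlier members of the chain. This is why any choice of complements will do. -/
theorem Splitting.toMap_mem_lift {C : SubspaceChain F E k} (σ : C.Splitting) (x : ∀ i, C.Gr i)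
    (i : Fin k) (T : Submodule F (C.Gr i)) :
    σ.toMap x ∈ C.lift i T ↔ x ∈ Submodule.flagLift i T := by
  have hmk : ∀ hv : σ.toMap x ∈ C.V i.succ, (∀ j, i < j → x j = 0) →
      ((C.V i.castSucc).submoduleOf (C.V i.succ)).mkQ ⟨σ.toMap x, hv⟩ = x i := by
    intro hv hx
    conv_rhs => rw [← σ.mkQ_s i (x i)]
    exact (Submodule.Quotient.eq _).2 (σ.toMap_sub_mem x i hx)
  constructor
  · rintro ⟨⟨v, hv⟩, hT, rfl⟩
    have hx : ∀ j, i < j → x j = 0 := fun j hj =>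
      σ.apply_eq_zero x i.succ hv j (Fin.succ_le_castSucc_iff.2 hj)
    refine ⟨?_, hx⟩
    rw [← hmk hv hx]
    exact hT
  · rintro ⟨hT, hx⟩
    have hv : σ.toMap x ∈ C.V i.succ := by
      have := Submodule.add_mem _ (C.le_succ i (σ.toMap_sub_mem x i hx)) (σ.s i (x i)).2
      rwa [sub_add_cancel] at this
    refine ⟨⟨_, hv⟩, ?_, rfl⟩
    change _ ∈ T
    rw [hmk hv hx]
    exact hT

end SubspaceChain

/-! ### Weak maps from the free product, its minors, and maximality -/

namespace QMatroid

/-- If the minors of `N` along a chain are isomorphic to `M₁, …, M_k`, then the identification of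
`M₁ □ ⋯ □ M_k` with `N` given by a splitting does not increase the rank. -/
theorem r_le_freeProductFamily_of_splitting {F E : Type*} [Field F] [AddCommGroup E] [Module F E]
    [FiniteDimensional F E] {k : ℕ} {G : Fin k → Type*} [∀ i, AddCommGroup (G i)]
    [∀ i, Module F (G i)] [∀ i, FiniteDimensional F (G i)] (N : QMatroid F E)
    (M : ∀ i, QMatroid F (G i)) (C : SubspaceChain F E k) (σ : C.Splitting)
    (τ : ∀ i, C.Gr i ≃ₗ[F] G i)
    (hτ : ∀ i (T : Submodule F (C.Gr i)),
      (M i).r (T.map (τ i : C.Gr i →ₗ[F] G i)) = (N.chainMinor C i).r T)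
    (X : Submodule F (∀ i, G i)) :
    N.r (X.comap (σ.toEquiv.symm ≪≫ₗ LinearEquiv.piCongrRight τ).toLinearMap) ≤
      (freeProductFamily k G M).r X := by
  set p := σ.toEquiv.symm ≪≫ₗ LinearEquiv.piCongrRight τ with hp
  have hU : ∀ i (T : Submodule F (G i)), (Submodule.flagLift i T).comap p.toLinearMap =
      C.lift i (T.comap (τ i : C.Gr i →ₗ[F] G i)) := by
    intro i T
    ext v
    obtain ⟨x, rfl⟩ := σ.toEquiv.surjective v
    refine Iff.trans ?_ (σ.toMap_mem_lift x i _).symm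
    simp [Submodule.mem_flagLift, hp]
  -- Since `p` is bijective, its kernel is zero and nothing is contracted.
  have key := N.r_comap_sub_le_freeProductFamily k G M p.toLinearMap p.surjective
    (fun i T => by
      rw [hU, hU, Submodule.comap_bot, LinearEquiv.ker, C.lift_bot]
      have := hτ i (T.comap (τ i : C.Gr i →ₗ[F] G i))
      rw [Submodule.map_comap_eq_of_surjective (τ i).surjective] at this
      exact this.ge) X
  rwa [LinearEquiv.ker, r_bot, sub_zero] at key

/-- The chain of the subspaces `E₁ ⊕ ⋯ ⊕ E_i` of `E₁ ⊕ ⋯ ⊕ E_k`. -/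
def _root_.SubspaceChain.pi (F : Type*) [Field F] {k : ℕ} (G : Fin k → Type*)
    [∀ i, AddCommGroup (G i)] [∀ i, Module F (G i)] [∀ i, Nontrivial (G i)] :
    SubspaceChain F (∀ i, G i) k where
  V i :=
    { carrier := {x | ∀ j : Fin k, i ≤ j.castSucc → x j = 0}
      add_mem' := fun {x y} hx hy j hj => by
        rw [Pi.add_apply, hx j hj, hy j hj, add_zero]
      zero_mem' := fun _ _ => rfl
      smul_mem' := fun c x hx j hj => by
        rw [Pi.smul_apply, hx j hj, smul_zero] }
  strictMono := by
    refine Fin.strictMono_iff_lt_succ.2 fun i => lt_of_le_of_ne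
      (fun x hx j hj => hx j ((Fin.castSucc_le_succ i).trans hj)) fun h => ?_
    -- A nonzero vector supported at `i` separates consecutive members; the chain is strict because
    -- the factors are nonzero.
    obtain ⟨a, ha⟩ := exists_ne (0 : G i)
    have h1 := (SetLike.ext_iff.1 h (Pi.single i a)).2 fun j hj =>
      Pi.single_eq_of_ne (Fin.succ_le_castSucc_iff.1 hj).ne' a
    have h2 := h1 i le_rfl
    rw [Pi.single_eq_same] at h2
    exact ha h2
  V_zero := by
    rw [eq_bot_iff]
    exact fun x hx => funext fun j => hx j (Fin.zero_le _)
  V_last := by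
    rw [eq_top_iff]
    exact fun x _ j hj => absurd hj (not_le.2 (Fin.castSucc_lt_last j))

/-- The free product lies in the class `𝓜_q(M₁, …, M_k)`. -/
theorem freeProductFamily_hasMinors {F : Type*} [Field F] (k : ℕ) (G : Fin k → Type*)
    [∀ i, AddCommGroup (G i)] [∀ i, Module F (G i)] [∀ i, FiniteDimensional F (G i)]
    [∀ i, Nontrivial (G i)] (M : ∀ i, QMatroid F (G i)) :
    (freeProductFamily k G M).HasMinors M := by
  refine ⟨SubspaceChain.pi F G, fun i => ?_⟩
  set C := SubspaceChain.pi F G with hC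
  set f : C.V i.succ →ₗ[F] G i := LinearMap.proj i ∘ₗ (C.V i.succ).subtype with hf
  have hmem : ∀ x : C.V i.succ, ∀ j, i < j → (x : ∀ i, G i) j = 0 := fun x j hj =>
    x.2 j (Fin.succ_le_castSucc_iff.2 hj)
  have hsurj : Function.Surjective f := fun a =>
    ⟨⟨Pi.single i a, fun j hj => Pi.single_eq_of_ne (Fin.succ_le_castSucc_iff.1 hj).ne' a⟩,
      Pi.single_eq_same i a⟩
  -- The `i`-th coordinate thus identifies the quotient of consecutive members with `G i`, and this
  -- identification is the required isomorphism of minors.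
  have hker : (C.V i.castSucc).submoduleOf (C.V i.succ) = LinearMap.ker f := by
    ext x
    refine ⟨fun hx => hx i le_rfl, fun hx j hj => ?_⟩
    rcases (Fin.castSucc_le_castSucc_iff.1 hj).eq_or_lt with rfl | hlt
    · exact hx
    · exact hmem x j hlt
  let e : C.Gr i ≃ₗ[F] G i :=
    (Submodule.quotEquivOfEq _ _ hker).trans (f.quotKerEquivOfSurjective hsurj)
  have he : ∀ x : C.V i.succ,
      e (((C.V i.castSucc).submoduleOf (C.V i.succ)).mkQ x) = (x : ∀ i, G i) i := fun x => rfl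
  refine ⟨e, fun T => ?_⟩
  have hlift : C.lift i T = Submodule.flagLift i (T.map (e : C.Gr i →ₗ[F] G i)) := by
    ext x
    constructor
    · rintro ⟨v, hv, rfl⟩
      exact ⟨⟨_, hv, he v⟩, hmem v⟩
    · rintro ⟨⟨t, ht, hte⟩, hx⟩
      have hv : x ∈ C.V i.succ := fun j hj => hx j (Fin.succ_le_castSucc_iff.1 hj)
      refine ⟨⟨x, hv⟩, ?_, rfl⟩
      have : ((C.V i.castSucc).submoduleOf (C.V i.succ)).mkQ ⟨x, hv⟩ = t :=
        e.injective ((he ⟨x, hv⟩).trans hte.symm)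
      change _ ∈ T
      rwa [this]
  have hbot : C.V i.castSucc = Submodule.flagLift i (⊥ : Submodule F (G i)) := by
    ext x
    refine ⟨fun hx => ⟨hx i le_rfl, fun j hj => hx j (Fin.castSucc_le_castSucc_iff.2 hj.le)⟩,
      fun hx j hj => ?_⟩
    rcases (Fin.castSucc_le_castSucc_iff.1 hj).eq_or_lt with rfl | hlt
    · exact hx.1
    · exact hx.2 j hlt
  rw [← freeProductFamily_r_flagLift k G M i, ← hlift, ← hbot]
  rfl

/-- If pulling back along a linear isomorphism does not increase the rank, then the isomorphism
preserves the rank as soon as `P ⪯ N`, because there are finitely many subspaces. -/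
theorem isomorphic_of_r_comap_le {F E₁ E₂ : Type*} [Field F] [Finite F]
    [AddCommGroup E₁] [Module F E₁] [FiniteDimensional F E₁] [AddCommGroup E₂] [Module F E₂]
    (N : QMatroid F E₂) (P : QMatroid F E₁) (p : E₂ ≃ₗ[F] E₁)
    (h : ∀ X, N.r (X.comap p.toLinearMap) ≤ P.r X) (hPN : WeakLE P N) : Isomorphic N P := by
  obtain ⟨ρ, hρ⟩ := hPN
  have : Finite E₁ := Module.finite_of_finite F
  have : Finite (Submodule F E₁) := Finite.of_injective _ SetLike.coe_injective
  cases nonempty_fintype (Submodule F E₁)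
  set τ := (Submodule.orderIsoMapComap p).symm with hτ
  have hτ' : ∀ X, τ X = X.comap p.toLinearMap := fun X => rfl
  -- `ρ ∘ τ` permutes the subspaces of `E₁`, so the chain `P.r (ρ (τ X)) ≤ N.r (τ X) ≤ P.r X` has
  -- equal sums at its two ends.
  have h1 : ∑ X, P.r (ρ (τ X)) = ∑ X, P.r X :=
    (τ.trans ρ).toEquiv.sum_comp fun X => P.r X
  have h2 : ∑ X, P.r (ρ (τ X)) ≤ ∑ X, N.r (τ X) := Finset.sum_le_sum fun X _ => hρ _
  have h3 : ∑ X, N.r (τ X) ≤ ∑ X, P.r X := Finset.sum_le_sum fun X _ => h X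
  have h4 := (Finset.sum_eq_sum_iff_of_le fun X _ => h X).1 (le_antisymm h3 (h1 ▸ h2))
  -- The isomorphism is the linear map `p`; the lattice isomorphism `ρ` need not be linear and
  -- serves only for counting.
  refine ⟨p, fun Y => ?_⟩
  rw [← h4 _ (Finset.mem_univ _), Submodule.comap_map_eq_of_injective p.injective]

end QMatroid

/-- The first part: under every identification of `V₁/V₀ ⊕ ⋯ ⊕ V_k/V_{k-1}` with `E` by a
splitting of the chain, the identity of `E` is a weak map from the free product of the minors
along the chain to `M`. The second part: the free product of `M₁, …, M_k` lies in
`𝓜_q(M₁, …, M_k)`, lies above all members in the weak order, and no member that is not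
isomorphic to it lies above it. -/
theorem mainTheorem4 {F : Type*} [Field F] [Finite F] :
    (∀ (E : Type*) [AddCommGroup E] [Module F E] [FiniteDimensional F E]
        (M : QMatroid F E) (k : ℕ) (C : SubspaceChain F E k) (σ : C.Splitting),
      QMatroid.IsWeakMap
        ((QMatroid.freeProductFamily k C.Gr (M.chainMinor C)).transport σ.toEquiv) M id) ∧
    (∀ (k : ℕ) (G : Fin k → Type*) [∀ i, AddCommGroup (G i)] [∀ i, Module F (G i)]
        [∀ i, FiniteDimensional F (G i)] [∀ i, Nontrivial (G i)] (M : ∀ i, QMatroid F (G i)),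
      (QMatroid.freeProductFamily k G M).HasMinors M ∧
      ∀ (E : Type*) [AddCommGroup E] [Module F E] [FiniteDimensional F E] (N : QMatroid F E),
        N.HasMinors M →
          QMatroid.WeakLE N (QMatroid.freeProductFamily k G M) ∧
          (QMatroid.WeakLE (QMatroid.freeProductFamily k G M) N →
            QMatroid.Isomorphic N (QMatroid.freeProductFamily k G M))) := by
  refine ⟨fun E _ _ _ M k C σ X => ?_, fun k G _ _ _ _ M =>
    ⟨QMatroid.freeProductFamily_hasMinors k G M, fun E _ _ _ N hN => ?_⟩⟩
  -- The minors are compared with themselves, so the isomorphisms `τ i` are identities.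
  · have h := M.r_le_freeProductFamily_of_splitting (M.chainMinor C) C σ
      (fun i => LinearEquiv.refl F _) (fun i T => congrArg _ (Submodule.map_id T))
      (X.comap σ.toEquiv.toLinearMap)
    refine le_trans (le_of_eq (congrArg M.r ?_)) h
    ext v
    simp
  · obtain ⟨C, hC⟩ := hN
    choose τ hτ using hC
    obtain ⟨σ⟩ := C.nonempty_splitting
    have h := N.r_le_freeProductFamily_of_splitting M C σ τ hτ
    exact ⟨⟨(Submodule.orderIsoMapComap (σ.toEquiv.symm ≪≫ₗ LinearEquiv.piCongrRight τ)).symm, h⟩,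
      QMatroid.isomorphic_of_r_comap_le N _ _ h⟩
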